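/- For a finite simple graph $G$ let $F(G)$ be the number of connected subgraphs of $G$ (with at least one vertex). Let $n,k$ be integers with $2\le k\le n-3$, and put $q=\lfloor (n-1)/k\rfloor$ and $r=n-1-kq$, so that $n-1=kq+r$ and $0\le r<k$. Let $P_m$ denote the path on $m$ vertices, and let $T_{n,k}$ be the graph obtained from the disjoint union $rP_{q+1}\cup(k-r)P_q$ by adding one new vertex $v$ and joining it to exactly one end vertex of each of these $k$ paths. Then $T_{n,k}$ is a tree on $n$ vertices with exactly $k$ leaves; it has a vertex of degree $k$ (namely $v$) whose removal leaves $rP_{q+1}\cup(k-r)P_q$; and it maximizes $F$ among all trees on $n$ vertices with exactly $k$ leaves, that is, $F(T)\le F(T_{n,k})$ for every such tree $T$. Moreover, $$F(T_{n,k})=(q+2)^r(q+1)^{k-r}+\frac{(q+1)(qk+2r)}{2}.$$ -/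

import Mathlib

/-- The core index `F(G)` of a finite graph: the number of connected subgraphs of `G`.
A connected subgraph has at least one vertex, and it need not be induced. -/
noncomputable def coreIndex {V : Type*} (G : SimpleGraph V) : ℕ :=
  {H : G.Subgraph | H.Connected}.ncard

/-- The degree of the vertex `v`, for a graph on a finite vertex set. -/
noncomputable def vertexDegree {V : Type*} (G : SimpleGraph V) (v : V) : ℕ :=
  (G.neighborSet v).ncard

/-- `G` is a tree on `n` vertices with exactly `k` leaves (vertices of degree one). -/
structure IsTreeWithLeaves {V : Type*} (n k : ℕ) (G : SimpleGraph V) : Prop where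
  isTree : G.IsTree
  card_vertices : Nat.card V = n
  card_leaves : {v : V | vertexDegree G v = 1}.ncard = k

/-- The disjoint union of `m` copies of the graph `G`. -/
def copies {V : Type*} (m : ℕ) (G : SimpleGraph V) : SimpleGraph (Fin m × V) where
  Adj x y := x.1 = y.1 ∧ G.Adj x.2 y.2
  symm := ⟨fun _ _ h => ⟨h.1.symm, h.2.symm⟩⟩
  loopless := ⟨fun x h => G.loopless.irrefl x.2 h.2⟩

/-- The disjoint union of `r` paths on `q + 1` vertices and `k - r` paths on `q` vertices. -/
def pathUnion (k q r : ℕ) : SimpleGraph ((Fin r × Fin (q + 1)) ⊕ (Fin (k - r) × Fin q)) :=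
  SimpleGraph.sum (copies r (SimpleGraph.pathGraph (q + 1)))
    (copies (k - r) (SimpleGraph.pathGraph q))

/-- The graph obtained from `G` by adding a new vertex `none` whose neighbours are exactly the
vertices of `G` that lie in `S`. -/
def addVertex {V : Type*} (G : SimpleGraph V) (S : Set V) : SimpleGraph (Option V) where
  Adj
    | none, none => False
    | none, some y => y ∈ S
    | some x, none => x ∈ S
    | some x, some y => G.Adj x y
  symm := ⟨fun x y h => by cases x <;> cases y <;> first | exact h | exact SimpleGraph.Adj.symm h⟩
  loopless := ⟨fun x h => by cases x <;> first | exact h | exact G.loopless.irrefl _ h⟩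

/-- The spider with `k` legs, of which `r` have `q + 1` vertices and `k - r` have `q` vertices:
a new vertex (the hub) is joined to one end, the vertex `0`, of each path of
`pathUnion k q r`. -/
def spider (k q r : ℕ) :
    SimpleGraph (Option ((Fin r × Fin (q + 1)) ⊕ (Fin (k - r) × Fin q))) :=
  addVertex (pathUnion k q r)
    {x | Sum.elim (fun a => (a.2 : ℕ)) (fun b => (b.2 : ℕ)) x = 0}

/-! In a rooted tree the subtrees through the root are counted by a product over the branches, each
contributing 1 plus the number of subtrees through its top. The subtrees avoiding the root are
counted by a sum over the branches.

The root can be chosen so that no branch has more subtrees through its top than the rest of the tree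
has through the root (`exists_balanced`): crossing into a heavier branch strictly lowers the number
of subtrees avoiding the root. From such a hub every branch can be unravelled into legs, keeping the
numbers of vertices and leaves (`forestBound_and_treeBound`). If the top of a branch carries a
subbranch `c` and further subbranches `s`, then `s` is moved to the hub. With `a` subtrees through
the hub outside the branch, the gain is `(s.rooted - 1) * (a - (1 + c.rooted))`, which balance makes
nonnegative. The result is a spider, and moving a vertex from a long leg to one shorter by at least
two does not lower the count (`legs_le`), so almost equal legs are optimal.

For graphs, `Realizes` builds trees by joining two rooted trees by one edge; the recursions for all
counts hold at each join. In a tree a connected subgraph is determined by its vertex set, so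
`coreIndex` is the sum of the two counts. -/

/-- The `x`-th triangular number, the number of connected subgraphs of a path on `x` vertices. -/
def tri : ℕ → ℕ
  | 0 => 0
  | x + 1 => tri x + (x + 1)

theorem two_mul_tri (x : ℕ) : 2 * tri x = x * (x + 1) := by
  induction x with
  | zero => rfl
  | succ x ih => simp only [tri]; linarith

/-! ### Plane forests and their subtree counts -/

/-- Ordered rooted forests: `cons c s` consists of a first tree, whose root has the forest `c` of
branches, followed by the forest `s`. A forest is also read as the rooted tree that arises by
joining its roots to one new root. -/
inductive PlaneForest
  | nil
  | cons (c s : PlaneForest)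

namespace PlaneForest

/-- The number of subtrees containing the root, in the rooted tree with branches `L`. -/
def rooted : PlaneForest → ℕ
  | nil => 1
  | cons c s => (1 + rooted c) * rooted s

/-- The number of nonempty subtrees of a forest. -/
def unrooted : PlaneForest → ℕ
  | nil => 0
  | cons c s => unrooted s + (rooted c + unrooted c)

/-- The number of vertices of a forest. -/
def size : PlaneForest → ℕ
  | nil => 0
  | cons c s => size s + (1 + size c)

/-- The number of trees of a forest. -/
def width : PlaneForest → ℕ
  | nil => 0
  | cons _ s => width s + 1

/-- The number of childless vertices of a forest. -/
def leaves : PlaneForest → ℕ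
  | nil => 0
  | cons c s => leaves s + (leaves c + if width c = 0 then 1 else 0)

/-- The number of childless vertices of the rooted tree with branches `L`. -/
def treeLeaves (L : PlaneForest) : ℕ := leaves L + if width L = 0 then 1 else 0

theorem leaves_cons (c s : PlaneForest) : (cons c s).leaves = s.leaves + c.treeLeaves := rfl

theorem eq_nil_of_width {L : PlaneForest} (h : L.width = 0) : L = nil := by
  cases L with
  | nil => rfl
  | cons c s => simp [width] at h

/-- The paths from the root to the vertices are distinct subtrees through the root. This later
bounds the length of a leg by a subtree count. -/
theorem size_lt_rooted (L : PlaneForest) : L.size + 1 ≤ L.rooted := by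
  induction L with
  | nil => simp [size, rooted]
  | cons c s hc hs =>
    simp only [size, rooted]
    calc s.size + (1 + c.size) + 1 ≤ (1 + (c.size + 1)) * (s.size + 1) := by nlinarith
      _ ≤ _ := by gcongr

theorem rooted_pos (L : PlaneForest) : 1 ≤ L.rooted := by
  have := L.size_lt_rooted; omega

/-! ### Balanced positions and the replacement of branches by legs -/

/-- In the tree consisting of the trees of `L` and further branches contributing the factor `a`,
each tree of `L` has at most as many subtrees containing its root as the rest of the tree. -/
def Balanced : ℕ → PlaneForest → Prop
  | _, nil => True
  | a, cons c s => c.rooted ≤ a * s.rooted ∧ Balanced (a * (1 + c.rooted)) s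

theorem Balanced.mono {L : PlaneForest} : ∀ {a b : ℕ}, Balanced a L → a ≤ b → Balanced b L := by
  induction L with
  | nil => intros; trivial
  | cons c s _ hs =>
    rintro a b ⟨h1, h2⟩ hab
    exact ⟨h1.trans (by gcongr), hs h2 (by gcongr)⟩

/-- Each single branch count is below the product over all branches. This supplies balance for
subbranches that have just been moved to the hub. -/
theorem balanced_of_rooted_le {L : PlaneForest} : ∀ {a : ℕ}, L.rooted ≤ a → Balanced a L := by
  induction L with
  | nil => intros; trivial
  | cons c s _ hs =>
    intro a h
    simp only [rooted] at h
    have h1 := rooted_pos s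
    have h2 := rooted_pos c
    exact ⟨by nlinarith, hs (by nlinarith)⟩

/-- The number of subtrees containing the hub, in the spider with legs `ℓ`. -/
abbrev legProd (ℓ : Multiset ℕ) : ℕ := (ℓ.map (· + 1)).prod

/-- The number of subtrees avoiding the hub, in the spider with legs `ℓ`. -/
abbrev legSum (ℓ : Multiset ℕ) : ℕ := (ℓ.map tri).sum

/-- In any balanced position, the trees of `L` can be replaced by as many legs as `L` has leaves
without decreasing the number of subtrees; `a` is the factor contributed by the other branches. -/
def ForestBound (L : PlaneForest) : Prop :=
  ∀ a, Balanced a L → ∃ ℓ : Multiset ℕ, ℓ.card = L.leaves ∧ ℓ.sum = L.size ∧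
    L.rooted ≤ legProd ℓ ∧ a * L.rooted + L.unrooted ≤ a * legProd ℓ + legSum ℓ

/-- The analogue of `ForestBound` for the single tree with branches `L`. -/
def TreeBound (L : PlaneForest) : Prop :=
  ∀ a, L.rooted ≤ a → ∃ ℓ : Multiset ℕ, ℓ.card = L.treeLeaves ∧ ℓ.sum = 1 + L.size ∧
    1 + L.rooted ≤ legProd ℓ ∧
    a * (1 + L.rooted) + (L.rooted + L.unrooted) ≤ a * legProd ℓ + legSum ℓ

/-- The first tree is replaced while `s` is still in place, then `s` is replaced next to the new
legs. The legs have at least as large a product, so `s` stays balanced; this is why both bounds also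
carry an inequality for `legProd`. -/
theorem ForestBound.cons {c s : PlaneForest} (hc : TreeBound c) (hs : ForestBound s) :
    ForestBound (cons c s) := by
  rintro a ⟨h1, h2⟩
  obtain ⟨ℓ₁, k1, m1, p1, b1⟩ := hc _ h1
  obtain ⟨ℓ₂, k2, m2, p2, b2⟩ := hs (a * legProd ℓ₁) (h2.mono (by gcongr))
  refine ⟨ℓ₂ + ℓ₁, by simp [k1, k2, leaves_cons], by simp [m1, m2, size], ?_, ?_⟩
  · simp only [legProd, Multiset.map_add, Multiset.prod_add, rooted] at *
    rw [mul_comm]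
    gcongr
  · simp only [legProd, legSum, Multiset.map_add, Multiset.prod_add, Multiset.sum_add, rooted,
      unrooted] at *
    nlinarith

/-- This treats a branch whose top has the single subbranch `c`: `c` is unravelled, and the extra
vertex lengthens any one of the resulting legs. -/
theorem exists_lengthen {c : PlaneForest} (hc : TreeBound c) {a : ℕ} (ha : 1 + c.rooted ≤ a) :
    ∃ ℓ : Multiset ℕ, ℓ.card = c.treeLeaves ∧ ℓ.sum = 2 + c.size ∧ 2 + c.rooted ≤ legProd ℓ ∧
      a * (2 + c.rooted) + (1 + c.rooted) + (c.rooted + c.unrooted) ≤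
        a * legProd ℓ + legSum ℓ := by
  -- Seen from `c`, the rest includes the extra vertex above it, hence the factor `a + 1`.
  obtain ⟨ℓ, k1, m1, p1, b1⟩ := hc (a + 1) (by omega)
  have hsize := c.size_lt_rooted
  obtain ⟨x, hx⟩ : ∃ x, x ∈ ℓ := by
    refine Multiset.exists_mem_of_ne_zero ?_
    rintro rfl
    simp at m1; omega
  obtain ⟨t, rfl⟩ := Multiset.exists_cons_of_mem hx
  simp only [legProd, legSum, Multiset.map_cons, Multiset.prod_cons, Multiset.sum_cons,
    Multiset.card_cons] at *
  have ht : 1 ≤ (t.map (· + 1)).prod := by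
    refine Nat.one_le_iff_ne_zero.2 (Multiset.prod_ne_zero ?_)
    simp
  refine ⟨(x + 1) ::ₘ t, by simpa using k1, by simp; omega, ?_, ?_⟩
  · simp only [Multiset.map_cons, Multiset.prod_cons]
    nlinarith
  · simp only [Multiset.map_cons, Multiset.prod_cons, Multiset.sum_cons, tri]
    generalize (t.map (· + 1)).prod = R at *
    -- With `R` the product over the other legs, the step reduces to `(x + 1) * (R - 1) ≤ a * (R -
    -- 1)`. The leg is no longer than the branch has vertices, so `x ≤ c.rooted`.
    have hxa : x + 1 ≤ a := by omega
    obtain ⟨R, rfl⟩ := Nat.exists_eq_add_of_le ht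
    obtain ⟨e, rfl⟩ := Nat.exists_eq_add_of_le hxa
    nlinarith [Nat.zero_le (e * R)]

/-- The subbranches `s` move to the hub, and the top of the branch stays above `c` alone. -/
theorem TreeBound.cons {c s : PlaneForest} (hc : TreeBound c) (hs : ForestBound s) :
    TreeBound (cons c s) := by
  intro a ha
  have hs1 := rooted_pos s
  simp only [rooted] at ha
  obtain ⟨ℓ₁, k1, m1, p1, b1⟩ := exists_lengthen hc (a := a * s.rooted) (by nlinarith)
  obtain ⟨ℓ₂, k2, m2, p2, b2⟩ := hs (a * legProd ℓ₁) (balanced_of_rooted_le (by nlinarith))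
  refine ⟨ℓ₂ + ℓ₁, ?_, by simp [m1, m2, size]; omega, ?_, ?_⟩
  · simp [k1, k2, treeLeaves, leaves, width]
  · simp only [legProd, Multiset.map_add, Multiset.prod_add, rooted] at *
    calc 1 + (1 + c.rooted) * s.rooted ≤ s.rooted * (2 + c.rooted) := by nlinarith
      _ ≤ _ := by gcongr
  · simp only [legProd, legSum, Multiset.map_add, Multiset.prod_add, Multiset.sum_add, rooted,
      unrooted] at *
    generalize (ℓ₁.map (· + 1)).prod = A at *
    generalize (ℓ₂.map (· + 1)).prod = B at *
    -- The gain of the move, `(s.rooted - 1) * (a - (1 + c.rooted)) ≥ 0`, without subtraction.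
    have key : a + (1 + c.rooted) * s.rooted ≤ a * s.rooted + (1 + c.rooted) := by
      obtain ⟨e, he⟩ := Nat.exists_eq_add_of_le hs1
      rw [he] at ha ⊢
      have hle : 1 + c.rooted ≤ a := by nlinarith
      nlinarith [Nat.mul_le_mul_right e hle]
    nlinarith

theorem forestBound_and_treeBound (L : PlaneForest) : ForestBound L ∧ TreeBound L := by
  induction L with
  | nil =>
    refine ⟨fun a _ => ⟨0, by simp [leaves, size, rooted, unrooted, legProd, legSum]⟩, fun a _ => ⟨{1}, ?_⟩⟩
    simp [treeLeaves, leaves, size, rooted, unrooted, width, tri, legProd, legSum]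
  | cons c s hc hs => exact ⟨.cons hc.2 hs.1, .cons hc.2 hs.1⟩

/-! ### Rerooting at a balanced vertex -/

/-- The forests agree in all counts that are independent of the order of the trees. -/
structure SameCounts (L M : PlaneForest) : Prop where
  rooted : L.rooted = M.rooted
  unrooted : L.unrooted = M.unrooted
  size : L.size = M.size
  width : L.width = M.width
  leaves : L.leaves = M.leaves

theorem exists_heavy_branch {L : PlaneForest} :
    ∀ {a : ℕ}, ¬ Balanced a L → ∃ c s, SameCounts L (cons c s) ∧ a * s.rooted < c.rooted := by
  induction L with
  | nil => intro a h; exact absurd trivial h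
  | cons c s _ hs =>
    intro a h
    by_cases h1 : c.rooted ≤ a * s.rooted
    · obtain ⟨c', s', ⟨e1, e2, e3, e4, e5⟩, h'⟩ := hs fun h2 => h ⟨h1, h2⟩
      refine ⟨c', cons c s', ⟨?_, ?_, ?_, ?_, ?_⟩, ?_⟩
      · simp only [rooted] at *; rw [e1]; ring
      · simp only [unrooted] at *; omega
      · simp only [size] at *; omega
      · simp only [width] at *; omega
      · simp only [leaves] at *; omega
      · simpa only [rooted, mul_assoc] using h'
    · exact ⟨c, s, ⟨rfl, rfl, rfl, rfl, rfl⟩, by omega⟩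

/-- The number of vertices of degree one of the rooted tree with branches `L`. -/
def degreeOneCount (L : PlaneForest) : ℕ := L.leaves + if L.width = 1 then 1 else 0

/-- The right side is symmetric in the two ends of the edge between the root and the top of `c`, so
the count survives rerooting across that edge. -/
theorem degreeOneCount_cons (c s : PlaneForest) :
    (cons c s).degreeOneCount = s.treeLeaves + c.treeLeaves := by
  simp only [degreeOneCount, leaves, width, treeLeaves]
  by_cases h : s.width = 0 <;> simp [h] ; omega

/-- Every rooted tree can be rerooted at a vertex that makes it balanced. -/
theorem exists_balanced (L : PlaneForest) :
    ∃ M : PlaneForest, Balanced 1 M ∧ M.size = L.size ∧ M.degreeOneCount = L.degreeOneCount ∧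
      M.rooted + M.unrooted = L.rooted + L.unrooted := by
  induction h : L.unrooted using Nat.strong_induction_on generalizing L with
  | _ N ih =>
    subst h
    by_cases hb : Balanced 1 L
    · exact ⟨L, hb, rfl, rfl, rfl⟩
    obtain ⟨c, s, ⟨e1, e2, e3, e4, e5⟩, h'⟩ := exists_heavy_branch hb
    have hd : L.degreeOneCount = (cons s c).degreeOneCount := by
      rw [degreeOneCount_cons, add_comm, ← degreeOneCount_cons, degreeOneCount, e5, e4]; rfl
    simp only [rooted, unrooted, size] at e1 e2 e3
    -- Crossing the edge to the heavy branch swaps `c` and `s`, which lowers the count avoiding the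
    -- root by `c.rooted - s.rooted > 0`.
    obtain ⟨M, hM, f1, f2, f3⟩ := ih (cons s c).unrooted (by simp only [unrooted]; omega) _ rfl
    refine ⟨M, hM, ?_, f2.trans hd.symm, ?_⟩
    · simp only [size] at f1; omega
    · simp only [rooted, unrooted] at f3; rw [f3, e1, e2]; ring

/-! ### Equalising the legs -/

theorem legs_le_of_mem {q : ℕ} {ℓ : Multiset ℕ} (h : ∀ x ∈ ℓ, x = q ∨ x = q + 1) :
    ∃ i j, ℓ.card = i + j ∧ ℓ.sum = (i + j) * q + i ∧
      legProd ℓ = (q + 2) ^ i * (q + 1) ^ j ∧ legSum ℓ = i * tri (q + 1) + j * tri q := by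
  induction ℓ using Multiset.induction with
  | empty => exact ⟨0, 0, by simp [legProd, legSum]⟩
  | cons x ℓ ih =>
    obtain ⟨i, j, h1, h2, h3, h4⟩ := ih fun y hy => h y (Multiset.mem_cons_of_mem hy)
    simp only [legProd, legSum] at *
    rcases h x (Multiset.mem_cons_self _ _) with rfl | rfl
    · exact ⟨i, j + 1, by simp [h1]; ring, by simp [h2]; ring, by simp [h3]; ring,
        by simp [h4]; ring⟩
    · exact ⟨i + 1, j, by simp [h1]; ring, by simp [h2]; ring, by simp [h3]; ring,
        by simp [h4]; ring⟩

/-- Among all choices of `k` legs with a given total length, legs of almost equal length are the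
best. -/
theorem legs_le {k q r : ℕ} (hr : r < k) (ℓ : Multiset ℕ) (hk : ℓ.card = k)
    (hs : ℓ.sum = k * q + r) :
    legProd ℓ + legSum ℓ ≤
      (q + 2) ^ r * (q + 1) ^ (k - r) + (r * tri (q + 1) + (k - r) * tri q) := by
  induction h : (ℓ.map (· ^ 2)).sum using Nat.strong_induction_on generalizing ℓ with
  | _ N ih =>
    subst h
    by_cases hex : ∃ x ∈ ℓ, ∃ y ∈ ℓ, y + 2 ≤ x
    · obtain ⟨x, hx, y, hy, hxy⟩ := hex
      obtain ⟨t, rfl⟩ := Multiset.exists_cons_of_mem hx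
      have hy' : y ∈ t := by
        rcases Multiset.mem_cons.1 hy with h | h
        · omega
        · exact h
      obtain ⟨t, rfl⟩ := Multiset.exists_cons_of_mem hy'
      obtain ⟨d, rfl⟩ := Nat.exists_eq_add_of_le hxy
      have ht : 1 ≤ (t.map (· + 1)).prod := by
        refine Nat.one_le_iff_ne_zero.2 (Multiset.prod_ne_zero ?_)
        simp
      -- Moving one vertex from leg `x = y + 2 + d` to leg `y` raises the product by `(d + 1) * R`,
      -- with `R ≥ 1` from the other legs. It lowers the triangular sum by only `d + 1`, and it
      -- lowers the sum of squares.
      refine le_trans ?_ (ih _ ?_ ((y + 1 + d) ::ₘ (y + 1) ::ₘ t) (by simpa using hk) ?_ rfl)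
      · simp only [legProd, legSum, Multiset.map_cons, Multiset.prod_cons, Multiset.sum_cons]
        have e : y + 2 + d = (y + 1 + d) + 1 := by ring
        rw [e]
        simp only [tri]
        generalize (t.map (· + 1)).prod = R at *
        nlinarith [Nat.zero_le d]
      · simp only [Multiset.map_cons, Multiset.sum_cons]
        nlinarith
      · simp only [Multiset.sum_cons] at hs ⊢
        omega
    · push Not at hex
      -- All lengths now differ by at most one. A leg below `q` would force the total below `k * q`,
      -- and one above `q + 1` would force it above `k * (q + 1)`.
      have hlow : ∀ x ∈ ℓ, q ≤ x := by
        intro x hx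
        by_contra hlt
        obtain ⟨t, rfl⟩ := Multiset.exists_cons_of_mem hx
        have := Multiset.sum_le_card_nsmul t q fun y hy => by
          have := hex y (Multiset.mem_cons_of_mem hy) x hx
          omega
        simp only [Multiset.sum_cons, Multiset.card_cons, smul_eq_mul] at *
        subst hk
        nlinarith
      have hhigh : ∀ x ∈ ℓ, x ≤ q + 1 := by
        intro x hx
        by_contra hlt
        obtain ⟨t, rfl⟩ := Multiset.exists_cons_of_mem hx
        have := Multiset.card_nsmul_le_sum (s := t) (a := q + 1) fun y hy => by
          have := hex x hx y (Multiset.mem_cons_of_mem hy)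
          omega
        simp only [Multiset.sum_cons, Multiset.card_cons, smul_eq_mul] at *
        subst hk
        nlinarith
      obtain ⟨i, j, h1, h2, h3, h4⟩ := legs_le_of_mem (q := q) (ℓ := ℓ) fun x hx => by
        have := hlow x hx
        have := hhigh x hx
        omega
      have hij : i + j = k := h1.symm.trans hk
      have hi : i = r := by rw [hij] at h2; omega
      subst hi
      have hj : k - i = j := by omega
      rw [h3, h4, hj]

/-- The bound on the number of subtrees of a tree with given numbers of vertices and leaves. -/
theorem rooted_add_unrooted_le {k q r : ℕ} (hr : r < k) (L : PlaneForest) (hL : 2 ≤ L.size)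
    (hsize : L.size = k * q + r) (hdeg : L.degreeOneCount = k) :
    L.rooted + L.unrooted ≤
      (q + 2) ^ r * (q + 1) ^ (k - r) + (r * tri (q + 1) + (k - r) * tri q) := by
  obtain ⟨M, hM, e1, e2, e3⟩ := exists_balanced L
  rw [← e3]
  -- A balanced root with a single branch `c` has `c.rooted ≤ 1`, so the tree would have only two
  -- vertices. Hence the root is no leaf, and the legs number exactly `k`.
  have hw : M.width ≠ 1 := by
    intro hw
    rcases M with _ | ⟨c, s⟩
    · simp [width] at hw
    · obtain rfl : s = nil := eq_nil_of_width (by simpa [width] using hw)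
      have h1 := hM.1
      have h2 := c.size_lt_rooted
      simp only [rooted, size] at h1 h2 e1
      omega
  obtain ⟨ℓ, k1, m1, -, b1⟩ := (forestBound_and_treeBound M).1 1 hM
  simp only [degreeOneCount, hw, if_false, add_zero] at e2 hdeg
  have := legs_le hr ℓ (by rw [k1, e2, hdeg]) (by rw [m1, e1, hsize])
  omega

end PlaneForest

/-! ### Connected vertex sets across a single joining edge -/

namespace SimpleGraph

variable {V : Type*} {G : SimpleGraph V}

/-- `S` is nonempty, and each partition of `S` into two nonempty parts is crossed by an edge. -/
def CutConnected (G : SimpleGraph V) (S : Set V) : Prop :=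
  S.Nonempty ∧ ∀ T : Set V, (∃ x ∈ S, x ∈ T) → (∃ y ∈ S, y ∉ T) →
    ∃ x ∈ S, ∃ y ∈ S, x ∈ T ∧ y ∉ T ∧ G.Adj x y

/-- The cut form avoids walks, which makes restricting a connected set to one side of a joining edge
a matter of set membership. -/
theorem cutConnected_iff {S : Set V} : G.CutConnected S ↔ (G.induce S).Connected := by
  constructor
  · rintro ⟨⟨x₀, hx₀⟩, h⟩
    have : Nonempty S := ⟨⟨x₀, hx₀⟩⟩
    refine ⟨fun a b => ?_⟩
    by_contra hab
    obtain ⟨x, hx, y, hy, ⟨hx', hxa⟩, hya, hadj⟩ :=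
      h {z | ∃ hz : z ∈ S, (G.induce S).Reachable a ⟨z, hz⟩} ⟨a, a.2, a.2, .refl _⟩
        ⟨b, b.2, fun ⟨_, hb⟩ => hab hb⟩
    exact hya ⟨hy, hxa.trans (Adj.reachable (by simpa using hadj))⟩
  · intro h
    refine ⟨Set.nonempty_coe_sort.1 h.nonempty, ?_⟩
    rintro T ⟨x, hxS, hxT⟩ ⟨y, hyS, hyT⟩
    obtain ⟨p⟩ := h.preconnected ⟨x, hxS⟩ ⟨y, hyS⟩
    obtain ⟨d, -, h1, h2⟩ := p.exists_boundary_dart (Subtype.val ⁻¹' T) hxT hyT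
    exact ⟨d.fst, d.fst.2, d.snd, d.snd.2, h1, h2, by simpa using d.adj⟩

/-- `A` and `B` are disjoint, and the edge from `v ∈ A` to `u ∈ B` is the only one between them. -/
structure JoinedAt (G : SimpleGraph V) (A B : Set V) (v u : V) : Prop where
  left_mem : v ∈ A
  right_mem : u ∈ B
  disjoint : ∀ x ∈ A, x ∉ B
  adj : G.Adj v u
  eq_of_adj : ∀ x ∈ A, ∀ y ∈ B, G.Adj x y → x = v ∧ y = u

namespace JoinedAt

variable {A B S T : Set V} {v u : V}

theorem symm (h : G.JoinedAt A B v u) : G.JoinedAt B A u v :=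
  ⟨h.right_mem, h.left_mem, fun x hx hx' => h.disjoint x hx' hx, h.adj.symm,
    fun x hx y hy hxy => (h.eq_of_adj y hy x hx hxy.symm).symm⟩

theorem mem_of_cutConnected (h : G.JoinedAt A B v u) (hS : S ⊆ A ∪ B) (hc : G.CutConnected S)
    {x y : V} (hx : x ∈ S) (hxA : x ∈ A) (hy : y ∈ S) (hyB : y ∈ B) : v ∈ S ∧ u ∈ S := by
  obtain ⟨a, ha, b, hb, haA, hbA, hab⟩ := hc.2 A ⟨x, hx, hxA⟩ ⟨y, hy, h.symm.disjoint y hyB⟩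
  obtain ⟨rfl, rfl⟩ := h.eq_of_adj a haA b ((hS hb).resolve_left hbA) hab
  exact ⟨ha, hb⟩

theorem cutConnected_inter_left (h : G.JoinedAt A B v u) (hS : S ⊆ A ∪ B)
    (hc : G.CutConnected S) (hv : v ∈ S) : G.CutConnected (S ∩ A) := by
  refine ⟨⟨v, hv, h.left_mem⟩, ?_⟩
  rintro T ⟨x, ⟨hxS, hxA⟩, hxT⟩ ⟨y, ⟨hyS, hyA⟩, hyT⟩
  have hd := h.disjoint
  have he := h.eq_of_adj
  have he' := h.symm.eq_of_adj
  by_cases hvT : v ∈ T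
  -- All of `B` is put on the side of `v`, so that the joining edge cannot be the one that crosses.
  · obtain ⟨a, ha, b, hb, haT, hbT, hab⟩ := hc.2 (T ∪ B) ⟨x, hxS, .inl hxT⟩
      ⟨y, hyS, fun h' => h'.elim hyT (hd y hyA)⟩
    have hbA : b ∈ A := (hS hb).resolve_right fun hb' => hbT (.inr hb')
    have haA : a ∈ A := (hS ha).resolve_right fun haB =>
      hbT (.inl ((he' a haB b hbA hab).2 ▸ hvT))
    exact ⟨a, ⟨ha, haA⟩, b, ⟨hb, hbA⟩, haT.resolve_right (hd a haA), fun h' => hbT (.inl h'), hab⟩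
  · obtain ⟨a, ha, b, hb, haT, hbT, hab⟩ := hc.2 (T ∩ A) ⟨x, hxS, hxT, hxA⟩
      ⟨y, hyS, fun h' => hyT h'.1⟩
    have hbA : b ∈ A := (hS hb).resolve_right fun hbB =>
      hvT ((he a haT.2 b hbB hab).1 ▸ haT.1)
    exact ⟨a, ⟨ha, haT.2⟩, b, ⟨hb, hbA⟩, haT.1, fun h' => hbT ⟨h', hbA⟩, hab⟩

theorem cutConnected_union (h : G.JoinedAt A B v u) (hS : G.CutConnected S) (hT : G.CutConnected T)
    (hv : v ∈ S) (hu : u ∈ T) : G.CutConnected (S ∪ T) := by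
  rw [cutConnected_iff] at *
  exact connected_induce_union hS.preconnected hT.preconnected hv hu h.adj

end JoinedAt

/-- The sets that induce connected subgraphs of `G`, lie in `A` and contain `v`. -/
def rootedSets (G : SimpleGraph V) (A : Set V) (v : V) : Set (Set V) :=
  {S | S ⊆ A ∧ v ∈ S ∧ G.CutConnected S}

/-- The sets that induce connected subgraphs of `G`, lie in `A` and avoid `v`. -/
def unrootedSets (G : SimpleGraph V) (A : Set V) (v : V) : Set (Set V) :=
  {S | S ⊆ A ∧ v ∉ S ∧ G.CutConnected S}

/-- A connected set through `v` splits uniquely into its part in `A`, which contains `v`, and its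
part in `B`, which is empty or contains `u`. -/
theorem JoinedAt.ncard_rootedSets [Finite V] {A B : Set V} {v u : V} (h : G.JoinedAt A B v u) :
    (G.rootedSets (A ∪ B) v).ncard = (1 + (G.rootedSets B u).ncard) * (G.rootedSets A v).ncard := by
  have hempty : ∅ ∉ G.rootedSets B u := fun h => h.2.1
  have hd := h.disjoint
  have himage : G.rootedSets (A ∪ B) v =
      (fun p : Set V × Set V => p.1 ∪ p.2) ''
        (insert ∅ (G.rootedSets B u) ×ˢ G.rootedSets A v) := by
    ext S
    constructor
    · rintro ⟨hS, hv, hc⟩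
      refine ⟨(S ∩ B, S ∩ A), ⟨?_, Set.inter_subset_right, ⟨hv, h.left_mem⟩,
        h.cutConnected_inter_left hS hc hv⟩, ?_⟩
      · rcases (S ∩ B).eq_empty_or_nonempty with he | ⟨y, hy, hyB⟩
        · exact .inl he
        · have hu := (h.mem_of_cutConnected hS hc hv h.left_mem hy hyB).2
          exact .inr ⟨Set.inter_subset_right, ⟨hu, h.right_mem⟩,
            h.symm.cutConnected_inter_left (by rwa [Set.union_comm]) hc hu⟩
      · simp only [← Set.inter_union_distrib_left]
        exact Set.inter_eq_left.2 (by rwa [Set.union_comm])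
    · rintro ⟨⟨S₁, S₂⟩, ⟨hS₁, hS₂, hv, hc⟩, rfl⟩
      rcases hS₁ with rfl | ⟨hS₁, hu, hc'⟩
      · exact ⟨by simpa using hS₂.trans Set.subset_union_left, by simpa using hv, by simpa using hc⟩
      · exact ⟨Set.union_subset (hS₁.trans Set.subset_union_right)
          (hS₂.trans Set.subset_union_left), .inr hv, h.symm.cutConnected_union hc' hc hu hv⟩
  rw [himage, Set.InjOn.ncard_image, Set.ncard_prod, Set.ncard_insert_of_notMem hempty,
    add_comm 1]
  rintro ⟨S₁, S₂⟩ ⟨h1, h2⟩ ⟨T₁, T₂⟩ ⟨h3, h4⟩ he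
  have hsub : ∀ {R}, R ∈ insert ∅ (G.rootedSets B u) → R ⊆ B := by
    rintro R (rfl | hR)
    · exact Set.empty_subset _
    · exact hR.1
  replace h1 := hsub h1
  replace h3 := hsub h3
  replace h2 := h2.1
  replace h4 := h4.1
  simp only [Set.ext_iff, Set.mem_union] at he
  simp only [Prod.mk.injEq, Set.ext_iff]
  simp only [Set.subset_def] at *
  constructor
  · intro x
    have := he x; have := h1 x; have := h2 x; have := h3 x; have := h4 x; have := hd x
    tauto
  · intro x
    have := he x; have := h1 x; have := h2 x; have := h3 x; have := h4 x; have := hd x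
    tauto

/-- A connected set meeting both sides contains `v`, so one avoiding `v` lies within one side. -/
theorem JoinedAt.ncard_unrootedSets [Finite V] {A B : Set V} {v u : V}
    (h : G.JoinedAt A B v u) :
    (G.unrootedSets (A ∪ B) v).ncard =
      (G.unrootedSets A v).ncard + ((G.rootedSets B u).ncard + (G.unrootedSets B u).ncard) := by
  have hunion : G.unrootedSets (A ∪ B) v =
      G.unrootedSets A v ∪ (G.rootedSets B u ∪ G.unrootedSets B u) := by
    ext S
    constructor
    · rintro ⟨hS, hv, hc⟩
      by_cases hA : S ⊆ A
      · exact .inl ⟨hA, hv, hc⟩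
      obtain ⟨y, hy, hyA⟩ := Set.not_subset.1 hA
      have hB : S ⊆ B := fun x hx => (hS hx).resolve_left fun hxA =>
        hv (h.mem_of_cutConnected hS hc hx hxA hy ((hS hy).resolve_left hyA)).1
      by_cases hu : u ∈ S
      · exact .inr (.inl ⟨hB, hu, hc⟩)
      · exact .inr (.inr ⟨hB, hu, hc⟩)
    · have hv := h.disjoint v h.left_mem
      rintro (⟨hS, hv', hc⟩ | ⟨hS, -, hc⟩ | ⟨hS, -, hc⟩)
      · exact ⟨hS.trans Set.subset_union_left, hv', hc⟩
      · exact ⟨hS.trans Set.subset_union_right, fun hv' => hv (hS hv'), hc⟩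
      · exact ⟨hS.trans Set.subset_union_right, fun hv' => hv (hS hv'), hc⟩
  have hdis : ∀ S, S ⊆ A → S ⊆ B → ¬ G.CutConnected S := by
    rintro S hA hB ⟨⟨x, hx⟩, -⟩
    exact h.disjoint x (hA hx) (hB hx)
  rw [hunion, Set.ncard_union_eq, Set.ncard_union_eq]
  · exact Set.disjoint_left.2 fun S h1 h2 => h2.2.1 h1.2.1
  · refine Set.disjoint_left.2 fun S h1 h2 => hdis S h1.1 ?_ h1.2.2
    rcases h2 with h2 | h2 <;> exact h2.1

/-! ### Graphs realizing a plane forest -/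

/-- The vertices of `A` other than `v` that have exactly one neighbour in `A`. -/
def leafSet (G : SimpleGraph V) (A : Set V) (v : V) : Set V :=
  {x ∈ A | x ≠ v ∧ (G.neighborSet x ∩ A).ncard = 1}

/-- The subgraph of `G` on `A` is a tree which, rooted at `v`, has the forest `L` of branches. -/
inductive Realizes (G : SimpleGraph V) : Set V → V → PlaneForest → Prop
  | single (v : V) : Realizes G {v} v .nil
  | join {A B : Set V} {v u : V} {s c : PlaneForest} (hA : Realizes G A v s)
      (hB : Realizes G B u c) (h : G.JoinedAt A B v u) : Realizes G (A ∪ B) v (.cons c s)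

namespace Realizes

variable {A : Set V} {v : V} {L : PlaneForest}

theorem root_mem (h : G.Realizes A v L) : v ∈ A := by
  induction h with
  | single => rfl
  | join _ _ h => exact .inl h.left_mem

theorem cutConnected (h : G.Realizes A v L) : G.CutConnected A := by
  induction h with
  | single v => exact cutConnected_iff.2 (by simp)
  | join _ _ h h1 h2 => exact h.cutConnected_union h1 h2 h.left_mem h.right_mem

theorem ncard_eq [Finite V] (h : G.Realizes A v L) : A.ncard = L.size + 1 := by
  induction h with
  | single v => simp [PlaneForest.size]
  | join _ _ h h1 h2 =>
    rw [Set.ncard_union_eq (Set.disjoint_left.2 h.disjoint), h1, h2, PlaneForest.size]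
    ring

theorem ncard_rootedSets [Finite V] (h : G.Realizes A v L) :
    (G.rootedSets A v).ncard = L.rooted := by
  induction h with
  | single v =>
    have : G.rootedSets {v} v = {{v}} := by
      ext S
      constructor
      · rintro ⟨h1, h2, -⟩
        exact h1.antisymm (Set.singleton_subset_iff.2 h2)
      · rintro rfl
        exact ⟨subset_rfl, rfl, (single v).cutConnected⟩
    rw [this, Set.ncard_singleton, PlaneForest.rooted]
  | join _ _ h h1 h2 => rw [h.ncard_rootedSets, h1, h2, PlaneForest.rooted]

theorem ncard_unrootedSets [Finite V] (h : G.Realizes A v L) :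
    (G.unrootedSets A v).ncard = L.unrooted := by
  induction h with
  | single v =>
    have : G.unrootedSets {v} v = ∅ := by
      refine Set.eq_empty_of_forall_notMem ?_
      rintro S ⟨h1, h2, ⟨x, hx⟩, -⟩
      obtain rfl := h1 hx
      exact h2 hx
    rw [this, Set.ncard_empty, PlaneForest.unrooted]
  | join _ hB h h1 h2 =>
    rw [h.ncard_unrootedSets, h1, h2, hB.ncard_rootedSets, PlaneForest.unrooted]

end Realizes

namespace JoinedAt

variable {A B : Set V} {v u : V}

theorem neighborSet_inter_of_ne (h : G.JoinedAt A B v u) {x : V} (hx : x ∈ A) (hxv : x ≠ v) :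
    G.neighborSet x ∩ (A ∪ B) = G.neighborSet x ∩ A := by
  ext y
  constructor
  · rintro ⟨hy, hy' | hy'⟩
    · exact ⟨hy, hy'⟩
    · exact absurd (h.eq_of_adj x hx y hy' hy).1 hxv
  · exact fun hy => ⟨hy.1, .inl hy.2⟩

theorem ncard_neighborSet_inter [Finite V] (h : G.JoinedAt A B v u) :
    (G.neighborSet v ∩ (A ∪ B)).ncard = (G.neighborSet v ∩ A).ncard + 1 := by
  have : G.neighborSet v ∩ (A ∪ B) = insert u (G.neighborSet v ∩ A) := by
    ext y
    constructor
    · rintro ⟨hy, hy' | hy'⟩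
      · exact .inr ⟨hy, hy'⟩
      · exact .inl (h.eq_of_adj v h.left_mem y hy' hy).2
    · rintro (rfl | hy)
      · exact ⟨h.adj, .inr h.right_mem⟩
      · exact ⟨hy.1, .inl hy.2⟩
  rw [this, Set.ncard_insert_of_notMem fun hu => h.disjoint u hu.2 h.right_mem]

/-- Away from `v` and `u` the neighbours are unchanged. The vertex `u` gains the neighbour `v`, so
it becomes a leaf exactly when it had no neighbour in `B`. -/
theorem leafSet_union [Finite V] (h : G.JoinedAt A B v u) :
    G.leafSet (A ∪ B) v = G.leafSet A v ∪
      (G.leafSet B u ∪ {x | x = u ∧ (G.neighborSet u ∩ B).ncard = 0}) := by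
  have hv := h.disjoint v h.left_mem
  have hn : (G.neighborSet u ∩ (A ∪ B)).ncard = (G.neighborSet u ∩ B).ncard + 1 := by
    rw [Set.union_comm]; exact h.symm.ncard_neighborSet_inter
  have hB : ∀ x ∈ B, x ≠ u → G.neighborSet x ∩ (A ∪ B) = G.neighborSet x ∩ B := fun x hx hxu => by
    rw [Set.union_comm]; exact h.symm.neighborSet_inter_of_ne hx hxu
  have hA : ∀ x ∈ A, x ≠ v → G.neighborSet x ∩ (A ∪ B) = G.neighborSet x ∩ A := fun x hx hxu =>
    h.neighborSet_inter_of_ne hx hxu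
  ext x
  constructor
  · rintro ⟨hx | hx, hxv, h1⟩
    · exact .inl ⟨hx, hxv, by rwa [hA x hx hxv] at h1⟩
    · by_cases hxu : x = u
      · subst hxu
        exact .inr (.inr ⟨rfl, by omega⟩)
      · exact .inr (.inl ⟨hx, hxu, by rwa [hB x hx hxu] at h1⟩)
  · rintro (⟨hx, hxv, h1⟩ | ⟨hx, hxu, h1⟩ | ⟨rfl, h1⟩)
    · exact ⟨.inl hx, hxv, by rwa [hA x hx hxv]⟩
    · exact ⟨.inr hx, fun hxv => hv (hxv ▸ hx), by rwa [hB x hx hxu]⟩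
    · exact ⟨.inr h.right_mem, h.adj.ne', by omega⟩

end JoinedAt

namespace Realizes

variable {A : Set V} {v : V} {L : PlaneForest}

theorem ncard_neighborSet_inter [Finite V] (h : G.Realizes A v L) :
    (G.neighborSet v ∩ A).ncard = L.width := by
  induction h with
  | single v =>
    have : G.neighborSet v ∩ {v} = ∅ := by
      ext y
      simp only [Set.mem_inter_iff, mem_neighborSet, Set.mem_singleton_iff, Set.mem_empty_iff_false,
        iff_false, not_and]
      exact fun hy => hy.ne'
    rw [this, Set.ncard_empty, PlaneForest.width]
  | join _ _ h h1 h2 => rw [h.ncard_neighborSet_inter, h1, PlaneForest.width]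

theorem ncard_leafSet [Finite V] (h : G.Realizes A v L) : (G.leafSet A v).ncard = L.leaves := by
  induction h with
  | single v =>
    have : G.leafSet {v} v = ∅ := Set.eq_empty_of_forall_notMem fun x hx => hx.2.1 hx.1
    rw [this, Set.ncard_empty, PlaneForest.leaves]
  | @join A B v u s c hA hB h h1 h2 =>
    rw [h.leafSet_union, hB.ncard_neighborSet_inter, Set.ncard_union_eq, Set.ncard_union_eq, h1, h2,
      PlaneForest.leaves]
    · congr 2
      by_cases hc : c.width = 0 <;> simp [hc]
    · exact Set.disjoint_left.2 fun x hx hx' => hx.2.1 hx'.1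
    · refine Set.disjoint_left.2 fun x hx hx' => h.disjoint x hx.1 ?_
      rcases hx' with hx' | ⟨rfl, -⟩
      · exact hx'.1
      · exact h.right_mem

/-- The number of leaves of a tree realizing `L`. -/
theorem ncard_leaves [Finite V] (h : G.Realizes Set.univ v L) :
    {x | vertexDegree G x = 1}.ncard = L.degreeOneCount := by
  have hw := h.ncard_neighborSet_inter
  have : {x | vertexDegree G x = 1} = G.leafSet Set.univ v ∪ {x | x = v ∧ L.width = 1} := by
    ext x
    simp only [leafSet, vertexDegree, Set.mem_ofPred_eq, Set.inter_univ, Set.mem_union, Set.mem_univ,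
      true_and] at *
    by_cases hx : x = v
    · subst hx; simp [hw]
    · simp [hx]
  rw [this, Set.ncard_union_eq, h.ncard_leafSet, PlaneForest.degreeOneCount]
  · congr 1
    by_cases hc : L.width = 1 <;> simp [hc]
  · exact Set.disjoint_left.2 fun x hx hx' => hx.2.1 hx'.1

/-- Every edge of a realized tree is the only edge across some cut. -/
theorem exists_cut (h : G.Realizes A v L) : ∀ x ∈ A, ∀ y ∈ A, G.Adj x y →
    ∃ T : Set V, x ∈ T ∧ y ∉ T ∧ ∀ a ∈ A, ∀ b ∈ A, a ∈ T → b ∉ T → G.Adj a b → a = x ∧ b = y := by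
  induction h with
  | single v =>
    rintro x rfl y rfl h
    exact absurd h (G.irrefl)
  | @join A B v u s c _ _ h h1 h2 =>
    have side : ∀ {A B : Set V} {v u : V}, G.JoinedAt A B v u → ∀ {x y : V}, x ∈ A → y ∈ A →
        (∃ T : Set V, x ∈ T ∧ y ∉ T ∧
          ∀ a ∈ A, ∀ b ∈ A, a ∈ T → b ∉ T → G.Adj a b → a = x ∧ b = y) →
        ∃ T : Set V, x ∈ T ∧ y ∉ T ∧ ∀ a ∈ A ∪ B, ∀ b ∈ A ∪ B, a ∈ T → b ∉ T → G.Adj a b →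
          a = x ∧ b = y := by
      rintro A B v u h x y hx hy ⟨T, hxT, hyT, hT⟩
      have hd := h.disjoint
      have he := h.eq_of_adj
      have he' := h.symm.eq_of_adj
      -- The whole of `B` joins the side of `v`, so the joining edge does not cross the extended
      -- cut.
      refine ⟨{z | z ∈ A ∧ z ∈ T ∨ z ∈ B ∧ v ∈ T}, .inl ⟨hx, hxT⟩, ?_, ?_⟩
      · rintro (h' | h')
        · exact hyT h'.2
        · exact hd y hy h'.1
      · rintro a - b hb ha' hb' hab
        simp only [Set.mem_ofPred_eq, not_or, not_and] at ha' hb'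
        rcases ha' with ⟨haA, haT⟩ | ⟨haB, hvT⟩ <;> rcases hb with hbA | hbB
        · exact hT a haA b hbA haT (hb'.1 hbA) hab
        · obtain ⟨rfl, rfl⟩ := he a haA b hbB hab
          exact absurd haT (hb'.2 hbB)
        · obtain ⟨rfl, rfl⟩ := he' a haB b hbA hab
          exact absurd hvT (hb'.1 hbA)
        · exact absurd hvT (hb'.2 hbB)
    have hd := h.disjoint
    rintro x (hx | hx) y (hy | hy) hxy
    · exact side h hx hy (h1 x hx y hy hxy)
    · refine ⟨A, hx, fun hy' => hd y hy' hy, fun a _ b hb ha hb' hab => ?_⟩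
      obtain ⟨rfl, rfl⟩ := h.eq_of_adj x hx y hy hxy
      exact h.eq_of_adj a ha b (hb.resolve_left hb') hab
    · refine ⟨B, hx, hd y hy, fun a _ b hb ha hb' hab => ?_⟩
      obtain ⟨rfl, rfl⟩ := h.symm.eq_of_adj x hx y hy hxy
      exact h.symm.eq_of_adj a ha b (hb.resolve_right hb') hab
    · rw [Set.union_comm]
      exact side h.symm hx hy (h2 x hx y hy hxy)

theorem isTree (h : G.Realizes Set.univ v L) : G.IsTree := by
  refine ⟨?_, isAcyclic_iff_forall_adj_isBridge.2 fun x y hxy => isBridge_iff.2 ?_⟩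
  · exact (induceUnivIso G).connected_iff.1 (cutConnected_iff.1 h.cutConnected)
  · rintro ⟨p⟩
    obtain ⟨T, hx, hy, hT⟩ := h.exists_cut x trivial y trivial hxy
    obtain ⟨d, -, h1, h2⟩ := p.exists_boundary_dart T hx hy
    have hd := d.adj
    rw [deleteEdges_adj] at hd
    obtain ⟨e1, e2⟩ := hT _ trivial _ trivial h1 h2 hd.1
    rw [e1, e2] at hd
    exact hd.2 rfl

/-- The new vertex is a leaf hung on `p`; the induction follows the side of the join that contains
`p`. -/
theorem exists_insert (h : G.Realizes A v L) : ∀ {x p : V}, x ∉ A → p ∈ A → G.Adj p x →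
    (∀ y ∈ A, G.Adj y x → y = p) → ∃ M, G.Realizes (insert x A) v M := by
  induction h with
  | single v =>
    rintro x p hx rfl hpx -
    refine ⟨.cons .nil .nil, ?_⟩
    rw [← Set.union_singleton]
    exact .join (.single _) (.single x) ⟨rfl, rfl, fun y hy hy' => hx (hy'.symm.trans hy), hpx,
      fun y hy z hz _ => ⟨hy, hz⟩⟩
  | @join A B v u s c hA hB h h1 h2 =>
    intro x p hx hp hpx huniq
    rw [Set.mem_union, not_or] at hx
    have hd := h.disjoint
    rcases hp with hp | hp
    · obtain ⟨M, hM⟩ := h1 hx.1 hp hpx fun y hy => huniq y (.inl hy)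
      refine ⟨.cons c M, ?_⟩
      rw [← Set.insert_union]
      refine .join hM hB ⟨.inr h.left_mem, h.right_mem, ?_, h.adj, ?_⟩
      · rintro y (rfl | hy)
        · exact hx.2
        · exact hd y hy
      · rintro y (rfl | hy) z hz hyz
        · obtain rfl := huniq z (.inr hz) hyz.symm
          exact absurd hz (hd z hp)
        · exact h.eq_of_adj y hy z hz hyz
    · obtain ⟨M, hM⟩ := h2 hx.2 hp hpx fun y hy => huniq y (.inr hy)
      refine ⟨.cons M s, ?_⟩
      rw [← Set.union_insert]
      refine .join hA hM ⟨h.left_mem, .inr h.right_mem, ?_, h.adj, ?_⟩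
      · rintro y hy (rfl | hy')
        · exact hx.1 hy
        · exact hd y hy hy'
      · rintro y hy z (rfl | hz) hyz
        · obtain rfl := huniq y (.inl hy) hyz
          exact absurd hp (hd y hy)
        · exact h.eq_of_adj y hy z hz hyz

end Realizes

end SimpleGraph

/-! ### Arbitrary finite trees, and connected subgraphs as vertex sets -/

namespace SimpleGraph

variable {V : Type*} {G : SimpleGraph V}

/-- A second neighbour `y` of `x` in `A` would give a route from `p` through `A` to `y` and on to
`x`, although the edge from `p` to `x` is a bridge. -/
theorem IsAcyclic.eq_of_adj_of_cutConnected (hG : G.IsAcyclic) {A : Set V} (hA : G.CutConnected A)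
    {x p y : V} (hx : x ∉ A) (hp : p ∈ A) (hpx : G.Adj p x) (hy : y ∈ A) (hyx : G.Adj y x) :
    y = p := by
  by_contra hne
  refine isBridge_iff.1 (isAcyclic_iff_forall_adj_isBridge.1 hG hpx) ?_
  let hom : G.induce A →g G.deleteEdges {s(p, x)} :=
    { toFun := Subtype.val
      map_rel' := by
        rintro ⟨a, ha⟩ ⟨b, hb⟩ hab
        rw [deleteEdges_adj]
        refine ⟨hab, fun h => ?_⟩
        have : x ∈ s(a, b) := by
          rw [Set.mem_singleton_iff] at h
          rw [h]; exact Sym2.mem_mk_right _ _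
        rcases Sym2.mem_iff.1 this with rfl | rfl
        · exact hx ha
        · exact hx hb }
  have hreach := ((cutConnected_iff.1 hA).preconnected ⟨p, hp⟩ ⟨y, hy⟩).map hom
  refine hreach.trans (Adj.reachable ?_)
  change (G.deleteEdges {s(p, x)}).Adj y x
  rw [deleteEdges_adj]
  refine ⟨hyx, fun h => hne ?_⟩
  have hp' := hpx.ne
  simp only [Set.mem_singleton_iff, Sym2.eq_iff] at h
  grind

/-- Every finite tree, rooted at any vertex, arises from a plane forest. -/
theorem IsTree.exists_realizes [Finite V] (hG : G.IsTree) (v : V) :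
    ∃ L, G.Realizes Set.univ v L := by
  have key : ∀ m, m + 1 ≤ Nat.card V → ∃ A L, G.Realizes A v L ∧ A.ncard = m + 1 := by
    intro m
    induction m with
    | zero => exact fun _ => ⟨{v}, .nil, .single v, by simp⟩
    | succ m ih =>
      intro hm
      obtain ⟨A, L, hA, hc⟩ := ih (by omega)
      obtain ⟨y, hy⟩ : ∃ y, y ∉ A := by
        by_contra! h
        rw [Set.eq_univ_of_forall h, Set.ncard_univ] at hc
        omega
      obtain ⟨w⟩ := hG.connected.preconnected v y
      -- The walk leaves `A` along some edge, whose outer end is the next leaf to attach.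
      obtain ⟨d, -, hp, hx⟩ := w.exists_boundary_dart A hA.root_mem hy
      obtain ⟨M, hM⟩ := hA.exists_insert hx hp d.adj fun z hz hzx =>
        hG.isAcyclic.eq_of_adj_of_cutConnected hA.cutConnected hx hp d.adj hz hzx
      exact ⟨_, M, hM, by rw [Set.ncard_insert_of_notMem hx, hc]⟩
  have : Nonempty V := ⟨v⟩
  have hpos : 0 < Nat.card V := Nat.card_pos
  obtain ⟨A, L, hA, hc⟩ := key (Nat.card V - 1) (by omega)
  have hA' : A = Set.univ := Set.eq_of_subset_of_ncard_le (Set.subset_univ _)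
    (by rw [Set.ncard_univ]; omega)
  exact ⟨L, hA' ▸ hA⟩

/-- If `H` missed the edge, a route inside `H` would join its ends, although the edge is a bridge.
Hence connected subgraphs of a forest are induced. -/
theorem IsAcyclic.subgraph_adj (hG : G.IsAcyclic) {H : G.Subgraph} (hH : H.Connected) {x y : V}
    (hx : x ∈ H.verts) (hy : y ∈ H.verts) (hxy : G.Adj x y) : H.Adj x y := by
  by_contra hn
  refine isBridge_iff.1 (isAcyclic_iff_forall_adj_isBridge.1 hG hxy) ?_
  let hom : H.coe →g G.deleteEdges {s(x, y)} :=
    { toFun := Subtype.val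
      map_rel' := by
        rintro ⟨a, ha⟩ ⟨b, hb⟩ hab
        have hab' : H.Adj a b := hab
        rw [deleteEdges_adj]
        refine ⟨hab'.adj_sub, fun h => hn ?_⟩
        rcases Sym2.eq_iff.1 h with ⟨rfl, rfl⟩ | ⟨rfl, rfl⟩
        · exact hab'
        · exact hab'.symm }
  exact (hH.preconnected.coe ⟨x, hx⟩ ⟨y, hy⟩).map hom

theorem IsAcyclic.coreIndex_eq (hG : G.IsAcyclic) :
    coreIndex G = {S : Set V | G.CutConnected S}.ncard := by
  have himage : {S : Set V | G.CutConnected S} =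
      Subgraph.verts '' {H : G.Subgraph | H.Connected} := by
    ext S
    constructor
    · intro hS
      exact ⟨(⊤ : G.Subgraph).induce S, connected_induce_iff.1 (cutConnected_iff.1 hS), rfl⟩
    · rintro ⟨H, hH, rfl⟩
      exact cutConnected_iff.2 (Subgraph.Connected.induce_verts hH)
  rw [himage, Set.InjOn.ncard_image]
  · rfl
  · intro H hH K hK h
    ext x y
    · rw [h]
    · constructor
      · intro hxy
        exact hG.subgraph_adj hK (h ▸ hxy.fst_mem) (h ▸ hxy.snd_mem) hxy.adj_sub
      · intro hxy
        exact hG.subgraph_adj hH (h ▸ hxy.fst_mem) (h ▸ hxy.snd_mem) hxy.adj_sub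

namespace Realizes

variable {v : V} {L : PlaneForest}

theorem coreIndex_eq [Finite V] (h : G.Realizes Set.univ v L) :
    coreIndex G = L.rooted + L.unrooted := by
  rw [h.isTree.isAcyclic.coreIndex_eq, ← h.ncard_rootedSets, ← h.ncard_unrootedSets,
    ← Set.ncard_union_eq]
  · congr 1
    ext S
    by_cases hv : v ∈ S <;> simp [rootedSets, unrootedSets, hv]
  · exact Set.disjoint_left.2 fun S h1 h2 => h2.2.1 h1.2.1

theorem isTreeWithLeaves [Finite V] (h : G.Realizes Set.univ v L) :
    IsTreeWithLeaves (L.size + 1) L.degreeOneCount G :=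
  ⟨h.isTree, by rw [← Set.ncard_univ, h.ncard_eq], h.ncard_leaves⟩

theorem vertexDegree_eq [Finite V] (h : G.Realizes Set.univ v L) :
    vertexDegree G v = L.width := by
  rw [← h.ncard_neighborSet_inter, Set.inter_univ, vertexDegree]

end Realizes

/-- The number of connected subgraphs of a tree with `k * q + r + 1` vertices and `k` leaves. -/
theorem coreIndex_le {V : Type*} [Finite V] {G : SimpleGraph V} {k q r : ℕ} (hr : r < k)
    (hn : 2 ≤ k * q + r) (hG : IsTreeWithLeaves (k * q + r + 1) k G) :
    coreIndex G ≤ (q + 2) ^ r * (q + 1) ^ (k - r) + (r * tri (q + 1) + (k - r) * tri q) := by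
  obtain ⟨v⟩ := hG.isTree.connected.nonempty
  obtain ⟨L, hL⟩ := hG.isTree.exists_realizes v
  have h := hL.isTreeWithLeaves
  have hsize : L.size = k * q + r := by
    have := h.card_vertices.symm.trans hG.card_vertices
    omega
  rw [hL.coreIndex_eq]
  exact L.rooted_add_unrooted_le hr (hsize ▸ hn) hsize (h.card_leaves.symm.trans hG.card_leaves)

end SimpleGraph

/-! ### The counts of the spider -/

namespace PlaneForest

/-- The branches of a path on `d + 1` vertices, rooted at an end. -/
def chain : ℕ → PlaneForest
  | 0 => nil
  | d + 1 => cons (chain d) nil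

theorem chain_counts (d : ℕ) : (chain d).rooted = d + 1 ∧ (chain d).unrooted = tri d ∧
    (chain d).size = d ∧ (chain d).treeLeaves = 1 := by
  induction d with
  | zero => simp [chain, rooted, unrooted, tri, size, treeLeaves, leaves, width]
  | succ d ih =>
    obtain ⟨h1, h2, h3, h4⟩ := ih
    simp only [treeLeaves] at h4
    simp [chain, rooted, unrooted, tri, size, treeLeaves, leaves, width, h1, h2, h3, h4]
    omega

end PlaneForest

namespace SimpleGraph

variable {V : Type*} {G : SimpleGraph V}

theorem realizes_path {m : ℕ} {x : Fin m → V} (hx : Function.Injective x)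
    (hadj : ∀ i j, G.Adj (x i) (x j) ↔ (i : ℕ) + 1 = j ∨ (j : ℕ) + 1 = i) (d : ℕ) :
    ∀ i : Fin m, (i : ℕ) + d + 1 = m → G.Realizes (x '' {j | i ≤ j}) (x i) (.chain d) := by
  induction d with
  | zero =>
    intro i hi
    have : {j | i ≤ j} = {i} := by
      ext j
      simp only [Set.mem_ofPred_eq, Set.mem_singleton_iff, Fin.le_def, Fin.ext_iff]
      omega
    rw [this, Set.image_singleton]
    exact .single _
  | succ d ih =>
    intro i hi
    have h := ih ⟨i + 1, by omega⟩ (by simp only; omega)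
    have : {j | i ≤ j} = {i} ∪ {j : Fin m | ⟨i + 1, by omega⟩ ≤ j} := by
      ext j
      simp only [Set.mem_ofPred_eq, Set.mem_union, Set.mem_singleton_iff, Fin.le_def, Fin.ext_iff]
      omega
    rw [this, Set.image_union, Set.image_singleton]
    refine .join (.single _) h ⟨rfl, ⟨_, by simp, rfl⟩, ?_, (hadj _ _).2 (.inl rfl), ?_⟩
    · rintro _ rfl ⟨j, hj, hji⟩
      obtain rfl := hx hji
      simp [Fin.le_def] at hj
    · rintro _ rfl _ ⟨j, hj, rfl⟩ hij
      refine ⟨rfl, congrArg x ?_⟩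
      simp only [Set.mem_ofPred_eq, Fin.le_def] at hj
      simp only [hadj] at hij
      exact Fin.ext (by simp only; omega)

/-- A hub joined to the ends of disjoint paths. -/
theorem exists_realizes_star {ι : Type*} {hub : V} {leg : ι → Set V} {top : ι → V}
    {len : ι → ℕ} (hleg : ∀ i, G.Realizes (leg i) (top i) (.chain (len i)))
    (hhub : ∀ i, hub ∉ leg i) (hadj : ∀ i, G.Adj hub (top i))
    (hadj' : ∀ i, ∀ x ∈ leg i, G.Adj hub x → x = top i)
    (hdisj : ∀ i j, i ≠ j → ∀ x ∈ leg i, ∀ y ∈ leg j, x ≠ y ∧ ¬ G.Adj x y) (s : Finset ι) :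
    ∃ L, G.Realizes (insert hub (⋃ i ∈ s, leg i)) hub L ∧ L.rooted = ∏ i ∈ s, (len i + 2) ∧
      L.unrooted = ∑ i ∈ s, tri (len i + 1) ∧ L.size = ∑ i ∈ s, (len i + 1) ∧
      L.width = s.card ∧ L.leaves = s.card := by
  classical
  induction s using Finset.induction_on with
  | empty =>
    refine ⟨.nil, by simpa using Realizes.single hub, ?_⟩
    simp [PlaneForest.rooted, PlaneForest.unrooted, PlaneForest.size, PlaneForest.width,
      PlaneForest.leaves]
  | insert i s hi ih =>
    obtain ⟨L, hL, h1, h2, h3, h4, h5⟩ := ih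
    obtain ⟨c1, c2, c3, c4⟩ := PlaneForest.chain_counts (len i)
    have hset : insert hub (⋃ j ∈ insert i s, leg j) = insert hub (⋃ j ∈ s, leg j) ∪ leg i := by
      rw [Finset.set_biUnion_insert, Set.insert_union, Set.union_comm]
    have hne : ∀ j ∈ s, j ≠ i := fun j hj h => hi (h ▸ hj)
    refine ⟨.cons (.chain (len i)) L, ?_, ?_, ?_, ?_, ?_, ?_⟩
    · rw [hset]
      refine .join hL (hleg i) ⟨.inl rfl, (hleg i).root_mem, ?_, hadj i, ?_⟩
      · rintro x (rfl | hx) hxi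
        · exact hhub i hxi
        · obtain ⟨j, hj, hxj⟩ := Set.mem_iUnion₂.1 hx
          exact (hdisj j i (hne j hj) x hxj x hxi).1 rfl
      · rintro x (rfl | hx) y hy hxy
        · exact ⟨rfl, hadj' i y hy hxy⟩
        · obtain ⟨j, hj, hxj⟩ := Set.mem_iUnion₂.1 hx
          exact absurd hxy (hdisj j i (hne j hj) x hxj y hy).2
    · rw [Finset.prod_insert hi, PlaneForest.rooted, h1, c1]; ring
    · rw [Finset.sum_insert hi, PlaneForest.unrooted, h2, c1, c2, tri]; ring
    · rw [Finset.sum_insert hi, PlaneForest.size, h3, c3]; ring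
    · rw [Finset.card_insert_of_notMem hi, PlaneForest.width, h4]
    · rw [Finset.card_insert_of_notMem hi, PlaneForest.leaves_cons, h5, c4]

end SimpleGraph

/-- The legs of the spider. -/
def spiderLeg (k p r : ℕ) : Fin r ⊕ Fin (k - r) →
    Set (Option ((Fin r × Fin (p + 1 + 1)) ⊕ (Fin (k - r) × Fin (p + 1))))
  | .inl i => Set.range fun j => some (.inl (i, j))
  | .inr i => Set.range fun j => some (.inr (i, j))

/-- The neighbours of the hub of the spider. -/
def spiderTop (k p r : ℕ) : Fin r ⊕ Fin (k - r) →
    Option ((Fin r × Fin (p + 1 + 1)) ⊕ (Fin (k - r) × Fin (p + 1)))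
  | .inl i => some (.inl (i, 0))
  | .inr i => some (.inr (i, 0))

theorem spider_realizes_leg (k p r : ℕ) (i : Fin r ⊕ Fin (k - r)) :
    (spider k (p + 1) r).Realizes (spiderLeg k p r i) (spiderTop k p r i)
      (.chain (Sum.elim (fun _ => p + 1) (fun _ => p) i)) := by
  rcases i with i | i
  · have := SimpleGraph.realizes_path (G := spider k (p + 1) r)
      (x := fun j : Fin (p + 1 + 1) => some (.inl (i, j))) (fun a b h => by simpa using h)
      (fun a b => by
        change (i = i ∧ (SimpleGraph.pathGraph (p + 1 + 1)).Adj a b) ↔ _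
        simp [SimpleGraph.pathGraph_adj]) (p + 1) 0 (by simp)
    simpa [spiderLeg, spiderTop] using this
  · have := SimpleGraph.realizes_path (G := spider k (p + 1) r)
      (x := fun j : Fin (p + 1) => some (.inr (i, j))) (fun a b h => by simpa using h)
      (fun a b => by
        change (i = i ∧ (SimpleGraph.pathGraph (p + 1)).Adj a b) ↔ _
        simp [SimpleGraph.pathGraph_adj]) p 0 (by simp)
    simpa [spiderLeg, spiderTop] using this

theorem exists_realizes_spider {k p r : ℕ} (hr : r < k) :
    ∃ L, (spider k (p + 1) r).Realizes Set.univ none L ∧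
      L.rooted = (p + 1 + 2) ^ r * (p + 1 + 1) ^ (k - r) ∧
      L.unrooted = r * tri (p + 1 + 1) + (k - r) * tri (p + 1) ∧
      L.size = k * (p + 1) + r ∧ L.width = k ∧ L.leaves = k := by
  obtain ⟨L, hL, h1, h2, h3, h4, h5⟩ := SimpleGraph.exists_realizes_star (hub := none)
    (spider_realizes_leg k p r) (by rintro (i | i) ⟨j, hj⟩ <;> simp at hj)
    (by rintro (i | i) <;> rfl)
    (by
      rintro (i | i) _ ⟨j, rfl⟩ h
      · have h : (j : ℕ) = 0 := h
        obtain rfl : j = 0 := Fin.ext h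
        rfl
      · have h : (j : ℕ) = 0 := h
        obtain rfl : j = 0 := Fin.ext h
        rfl)
    (by
      rintro (i | i) (i' | i') hii _ ⟨j, rfl⟩ _ ⟨j', rfl⟩
      · refine ⟨fun h => hii ?_, fun h => hii ?_⟩
        · simp only [Option.some.injEq, Sum.inl.injEq, Prod.mk.injEq] at h; rw [h.1]
        · have h : i = i' ∧ _ := h
          rw [h.1]
      · refine ⟨fun h => by simp at h, fun h => ?_⟩
        have h : (pathUnion k (p + 1) r).Adj (.inl (i, j)) (.inr (i', j')) := h
        simp [pathUnion] at h
      · refine ⟨fun h => by simp at h, fun h => ?_⟩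
        have h : (pathUnion k (p + 1) r).Adj (.inr (i, j)) (.inl (i', j')) := h
        simp [pathUnion] at h
      · refine ⟨fun h => hii ?_, fun h => hii ?_⟩
        · simp only [Option.some.injEq, Sum.inr.injEq, Prod.mk.injEq] at h; rw [h.1]
        · have h : i = i' ∧ _ := h
          rw [h.1])
    Finset.univ
  have huniv : insert none (⋃ i ∈ (Finset.univ : Finset (Fin r ⊕ Fin (k - r))),
      spiderLeg k p r i) = Set.univ := by
    refine Set.eq_univ_of_forall ?_
    rintro (_ | ⟨i, j⟩ | ⟨i, j⟩)
    · exact .inl rfl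
    · exact .inr (Set.mem_iUnion₂.2 ⟨.inl i, Finset.mem_univ _, j, rfl⟩)
    · exact .inr (Set.mem_iUnion₂.2 ⟨.inr i, Finset.mem_univ _, j, rfl⟩)
  rw [huniv] at hL
  have hcard : r + (k - r) = k := by omega
  refine ⟨L, hL, ?_, ?_, ?_, ?_, ?_⟩
  · simpa [Fintype.prod_sum_type] using h1
  · simpa [Fintype.sum_sum_type] using h2
  · rw [h3]
    simp only [Fintype.sum_sum_type, Sum.elim_inl, Sum.elim_inr, Finset.sum_const,
      Finset.card_univ, Fintype.card_fin, smul_eq_mul]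
    obtain ⟨t, rfl⟩ := Nat.exists_eq_add_of_lt hr
    rw [show r + t + 1 - r = t + 1 by omega]
    ring
  · simpa [hcard] using h4
  · simpa [hcard] using h5

/-- Removing the added vertex gives back the original graph. -/
noncomputable def addVertexInduceIso {V : Type*} (G : SimpleGraph V) (S : Set V) :
    (addVertex G S).induce {none}ᶜ ≃g G :=
  SimpleGraph.Iso.symm
    { toEquiv := Equiv.ofBijective (fun x : V => (⟨some x, by simp⟩ : ({none}ᶜ : Set (Option V))))
        ⟨fun x y h => by simpa using h, by
          rintro ⟨_ | x, hx⟩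
          · exact absurd rfl hx
          · exact ⟨x, rfl⟩⟩
      map_rel_iff' := Iff.rfl }

theorem theorem5p3 (n k q r : ℕ) (hk : 2 ≤ k) (hkn : k + 3 ≤ n)
    (hq : q = (n - 1) / k) (hr : r = n - 1 - k * q) :
    IsTreeWithLeaves n k (spider k q r) ∧
    (vertexDegree (spider k q r) none = k ∧
      Nonempty (((spider k q r).induce {none}ᶜ) ≃g pathUnion k q r)) ∧
    (∀ (V : Type*) [Finite V] (G : SimpleGraph V),
      IsTreeWithLeaves n k G → coreIndex G ≤ coreIndex (spider k q r)) ∧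
    (coreIndex (spider k q r) : ℚ) =
      ((q : ℚ) + 2) ^ r * ((q : ℚ) + 1) ^ (k - r) +
        ((q : ℚ) + 1) * ((q : ℚ) * k + 2 * r) / 2 := by
  have hmod : r = (n - 1) % k := by rw [hr, hq, Nat.mod_eq_sub]
  have hrk : r < k := hmod ▸ Nat.mod_lt _ (by omega)
  have hdiv : k * q + r = n - 1 := by rw [hmod, hq, Nat.div_add_mod]
  have hq1 : 1 ≤ q := hq ▸ (Nat.one_le_div_iff (by omega)).2 (by omega)
  obtain rfl : n = k * q + r + 1 := by omega
  clear hq hr hmod hdiv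
  -- Writing `q = p + 1` makes every leg nonempty, so each has an end vertex `0` to join to the hub.
  obtain ⟨p, rfl⟩ := Nat.exists_eq_add_of_le' hq1
  obtain ⟨L, hL, h1, h2, h3, h4, h5⟩ := exists_realizes_spider (p := p) hrk
  have hcore := hL.coreIndex_eq
  rw [h1, h2] at hcore
  have htree := hL.isTreeWithLeaves
  -- The hub has degree `k ≥ 2`, so it is not a leaf itself.
  rw [PlaneForest.degreeOneCount, h3, h4, h5, if_neg (by omega), add_zero] at htree
  refine ⟨htree, ⟨hL.vertexDegree_eq.trans h4, ⟨addVertexInduceIso _ _⟩⟩, ?_, ?_⟩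
  · intro V _ G hG
    rw [hcore]
    exact SimpleGraph.coreIndex_le hrk (by omega) hG
  · have t1 : (2 * tri (p + 1 + 1) : ℚ) = (p + 2) * (p + 3) := by
      have := two_mul_tri (p + 1 + 1)
      exact_mod_cast this
    have t2 : (2 * tri (p + 1) : ℚ) = (p + 1) * (p + 2) := by
      have := two_mul_tri (p + 1)
      exact_mod_cast this
    rw [hcore]
    push_cast [Nat.cast_sub hrk.le]
    linear_combination (r : ℚ) / 2 * t1 + ((k : ℚ) - r) / 2 * t2
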